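/- Let $\mathcal X\subset\mathbb R^d$, $\mathcal Y\subset\mathbb R$, $\mathcal Z=\mathcal X\times\mathcal Y$, and let $z_t=(x_t,y_t)$, $t=1,2,\dots$, be independent random examples with common law $\rho$, a probability measure on $\mathcal Z$. Let $H_K$ be the reproducing kernel Hilbert space, with norm $\|\cdot\|$, of a continuous, symmetric, positive semi-definite kernel $K:\mathcal X\times\mathcal X\to\mathbb R$ with $\kappa:=\sup_{x\in\mathcal X}\sqrt{K(x,x)}<\infty$, and write $K_x=K(x,\cdot)$. Let $\alpha\in(0,1]$, $L>0$, and let the loss $\phi:\mathcal Y\times\mathbb R\to[0,\infty)$ be measurable in its first argument and convex and differentiable in its second argument, with derivative $\phi'$ in the second argument satisfying $$|\phi'(y,s)-\phi'(y,\tilde s)|\le L|s-\tilde s|^\alpha\qquad\text{for all }s,\tilde s\in\mathbb R,\ y\in\mathcal Y.$$ Let $f_H\in H_K$ be a minimizer over $H_K$ of $\mathcal E(f)=\int_{\mathcal Z}\phi(y,f(x))\,d\rho(x,y)$, and assume $\sup_{y\in\mathcal Y}\phi(y,0)<\infty$ and $\sup_{(x,y)\in\mathcal Z}\phi(y,f_H(x))<\infty$.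 Let the online gradient descent iterates be $f_1=0$ and $$f_{t+1}=f_t-\eta_t\,\phi'(y_t,f_t(x_t))K_{x_t},\qquad t\ge 1,$$ with positive step sizes such that, for all $t\ge1$, $\eta_{t+1}\le\eta_t$ and $A\kappa^2\eta_t\le 1$, where $A=2\alpha^{\frac{1-\alpha}{1+\alpha}}L^{\frac{2}{1+\alpha}}(1+\alpha)$, and such that $\sum_{t=1}^\infty\eta_t^2<\infty$. Then there is a constant $\bar C\ge1$, independent of $T$ and $\delta$ (and of the realization of the examples), such that for every integer $T\ge1$ and every $\delta\in(0,1)$ with $T\ge2\delta$ (which holds for every $\delta\in(0,1)$ as soon as $T\ge2$), with probability at least $1-\delta$, $$\max_{1\le t\le T}\|f_t-f_H\|^2\le\bar C\log\frac T\delta .$$ -/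

import Mathlib

open MeasureTheory ProbabilityTheory Set

/-- The loss `φ : Y → ℝ → [0, ∞)` is measurable in its first argument, and is convex and
differentiable in its second argument with an `(α, L)`-Hölder continuous derivative. -/
structure IsHolderLoss {Y : Set ℝ} (φ : Y → ℝ → ℝ) (α L : ℝ) : Prop where
  measurable : ∀ s, Measurable fun y => φ y s
  nonneg : ∀ y s, 0 ≤ φ y s
  convex : ∀ y, ConvexOn ℝ univ (φ y)
  differentiable : ∀ y, Differentiable ℝ (φ y)
  holder : ∀ y s s', |deriv (φ y) s - deriv (φ y) s'| ≤ L * |s - s'| ^ α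

/-- The generalization error `∫ φ (y, f x) dρ (x, y)` of a prediction rule `f`. -/
noncomputable def genError {d : ℕ} {X : Set (EuclideanSpace ℝ (Fin d))} {Y : Set ℝ}
    (ρ : Measure (X × Y)) (φ : Y → ℝ → ℝ) (f : X → ℝ) : ℝ :=
  ∫ z, φ z.2 (f z.1) ∂ρ

section Kernel

variable {d : ℕ} {X : Set (EuclideanSpace ℝ (Fin d))} {Y : Set ℝ}
  (H : Type*) [NormedAddCommGroup H] [InnerProductSpace ℝ H] [CompleteSpace H] [RKHS ℝ H X ℝ]

/-- The kernel section `K_x = K (x, ·)`, as an element of `H`. -/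
noncomputable def kerSection (x : X) : H := RKHS.kerFun H x (1 : ℝ)

/-- The real-valued reproducing kernel `K (x, x')` of `H`. -/
noncomputable def realKernel (x x' : X) : ℝ := RKHS.kernel H x x' (1 : ℝ)

/-- `κ = sup_x √K(x, x)`. -/
noncomputable def kernelBound : ℝ := ⨆ x : X, √(realKernel H x x)

/-- Online gradient descent in `H`, without projection or regularization. Times are counted from
zero: `ogd H φ η z n`, `η n`, `z n` are the iterate, the step size, the example
number `n + 1`. The first iterate is `0`. -/
noncomputable def ogd (φ : Y → ℝ → ℝ) (η : ℕ → ℝ) (z : ℕ → X × Y) : ℕ → H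
  | 0 => 0
  | n + 1 => ogd φ η z n -
      (η n * deriv (φ (z n).2) ((ogd φ η z n : H) (z n).1)) • kerSection H (z n).1

end Kernel

/-- The constant `A = 2 α ^ ((1 - α) / (1 + α)) L ^ (2 / (1 + α)) (1 + α)` in the restriction on
the step sizes. -/
noncomputable def stepConstA (α L : ℝ) : ℝ :=
  2 * α ^ ((1 - α) / (1 + α)) * L ^ (2 / (1 + α)) * (1 + α)

/-! ### Losses with Hölder derivative: self-bounding, growth, measurability. -/

section Loss

variable {Y : Set ℝ} {φ : Y → ℝ → ℝ} {α L : ℝ}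

/-! Let `D_n` be the squared distance from the iterate to the minimizer. Convexity and the
self-bounding inequality `φ'² ≤ A φ + C` turn a gradient step into `D_{n+1} ≤ D_n - μ_n g_n +
O(η_n²)`, where `0 ≤ μ_n ≤ 2 η_n` and `g_n` is the excess loss on a fresh example
(`norm_gradient_step_sub_sq_le`). Given the past, `g_n` has nonnegative mean, so only its
fluctuations can push the iterate away.

The range of `g_n` is of order `1 + ‖f_n‖²`. Since the loss of the minimizer is at most some `B`,
`|g_n| ≤ g_n + 2B`, so the second moment is linear in that range, up to a multiple of the mean which
the drift absorbs (`lintegral_exp_neg_mul_le`). Hence, for small `l`, a step raises the exponent `l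
D_n` by at most `l c η_n² (1 + D_n)` (`exists_lintegral_exp_step_le`). One `l` serves all `n`
because `η_n ‖f_n‖²` is bounded on every sample path (`mul_norm_ogd_sq_le`).

As `∑ η_n²` converges, letting `l` decrease slowly with `n` cancels the factors `1 + c η_n²` and
keeps an exponential moment bounded (`exists_lintegral_exp_ogd_le`). Markov's inequality and a union
bound over `T` iterates give `log (T / δ)`. -/

lemma stepConstA_pos (hα : 0 < α) (hL : 0 < L) : 0 < stepConstA α L := by
  unfold stepConstA; positivity

/-- A differentiable convex function lies above its tangents. -/
lemma IsHolderLoss.tangent_le (hφ : IsHolderLoss φ α L) (y : Y) (s u : ℝ) :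
    φ y s + deriv (φ y) s * (u - s) ≤ φ y u := by
  have hd := (hφ.differentiable y s).hasDerivAt
  rcases lt_trichotomy s u with h | h | h
  · have := (hφ.convex y).le_slope_of_hasDerivAt (mem_univ _) (mem_univ _) h hd
    rw [slope_def_field, le_div_iff₀ (by linarith)] at this
    linarith
  · simp [h]
  · have := (hφ.convex y).slope_le_of_hasDerivAt (mem_univ _) (mem_univ _) h hd
    rw [slope_def_field, div_le_iff₀ (by linarith)] at this
    linarith

/-- The tangent at `u`, evaluated at `s`, replaces integration of the derivative; the lost factor `1
/ (1 + α)` is harmless below. -/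
lemma IsHolderLoss.le_descent (hφ : IsHolderLoss φ α L) (y : Y) (s u : ℝ) :
    φ y u ≤ φ y s + deriv (φ y) s * (u - s) + L * |u - s| ^ α * |u - s| := by
  have h1 := hφ.tangent_le y u s
  have h2 : (deriv (φ y) u - deriv (φ y) s) * (u - s) ≤ L * |u - s| ^ α * |u - s| := by
    refine (le_abs_self _).trans ?_
    rw [abs_mul]
    exact mul_le_mul_of_nonneg_right (hφ.holder y u s) (abs_nonneg _)
  linarith

/-- A nonnegative loss with Hölder derivative bounds the square of its derivative. -/
lemma IsHolderLoss.exists_deriv_sq_le (hφ : IsHolderLoss φ α L) (hα : 0 < α) (hα1 : α ≤ 1)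
    (hL : 0 < L) :
    ∃ C, 0 ≤ C ∧ ∀ y s, deriv (φ y) s ^ 2 ≤ stepConstA α L * φ y s + C := by
  have hA := stepConstA_pos hα hL
  set h : ℝ := 2 / stepConstA α L with hh
  have hpos : 0 < h := by positivity
  -- Beyond `M`, the Hölder remainder of a gradient step of length `h` costs at most half of the
  -- linear gain `h g²`; slopes below `M` go into the constant `M²`.
  obtain ⟨M, hM, hMle⟩ : ∃ M : ℝ, 0 < M ∧ L * h ^ α * M ^ (α - 1) ≤ 1 / 2 := by
    rcases hα1.lt_or_eq with h1 | h1
    · have ht : Filter.Tendsto (fun M : ℝ => L * h ^ α * M ^ (-(1 - α))) Filter.atTop (nhds 0) := by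
        simpa using (tendsto_rpow_neg_atTop (sub_pos.2 h1)).const_mul (L * h ^ α)
      obtain ⟨M, hM, hM0⟩ := ((ht.eventually (gt_mem_nhds (by norm_num : (0 : ℝ) < 1 / 2))).and
        (Filter.eventually_gt_atTop 0)).exists
      exact ⟨M, hM0, by simpa using hM.le⟩
    -- Only for `α = 1` does the size of `A` matter: `A = 4L`, so `L h = 1/2` exactly.
    · refine ⟨1, one_pos, le_of_eq ?_⟩
      rw [hh, h1, stepConstA]
      norm_num
      field_simp
  refine ⟨M ^ 2, by positivity, fun y s => ?_⟩
  set g := deriv (φ y) s with hg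
  rcases lt_or_ge |g| M with hgM | hgM
  · have := (sq_lt_sq' (by linarith [neg_abs_le g, abs_lt.1 hgM]) (abs_lt.1 hgM).2)
    nlinarith [hφ.nonneg y s]
  · have hg0 : 0 < |g| := hM.trans_le hgM
    have hd := hφ.le_descent y s (s - h * g)
    have h0 := hφ.nonneg y (s - h * g)
    have e1 : |s - h * g - s| = h * |g| := by
      rw [show s - h * g - s = -(h * g) by ring, abs_neg, abs_mul, abs_of_pos hpos]
    rw [e1, Real.mul_rpow hpos.le hg0.le] at hd
    have e2 : |g| ^ α = |g| ^ (α - 1) * |g| := by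
      rw [Real.rpow_sub_one hg0.ne', div_mul_cancel₀ _ hg0.ne']
    have e3 : |g| ^ (α - 1) ≤ M ^ (α - 1) :=
      Real.rpow_le_rpow_of_nonpos hM hgM (by linarith)
    have e4 : L * h ^ α * |g| ^ (α - 1) ≤ 1 / 2 :=
      (mul_le_mul_of_nonneg_left e3 (by positivity)).trans hMle
    have e5 : L * (h ^ α * |g| ^ α) * (h * |g|) ≤ 1 / 2 * (h * g ^ 2) := by
      rw [e2, show L * (h ^ α * (|g| ^ (α - 1) * |g|)) * (h * |g|)
        = (L * h ^ α * |g| ^ (α - 1)) * (h * |g| ^ 2) by ring, sq_abs]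
      exact mul_le_mul_of_nonneg_right e4 (by positivity)
    have e6 : h / 2 * g ^ 2 ≤ φ y s := by nlinarith
    have e7 : g ^ 2 = stepConstA α L * (h / 2 * g ^ 2) := by rw [hh]; field_simp
    rw [e7]
    nlinarith [mul_le_mul_of_nonneg_left e6 hA.le, sq_nonneg M]

/-- Expand at `0`, where self-bounding controls the slope uniformly in `y`; the remainder has degree
`1 + α ≤ 2`. -/
lemma IsHolderLoss.exists_le_quadratic (hφ : IsHolderLoss φ α L) (hα : 0 < α) (hα1 : α ≤ 1)
    (hL : 0 < L) (hφ0 : BddAbove (range fun y : Y => φ y 0)) :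
    ∃ G, 0 ≤ G ∧ ∀ y s, φ y s ≤ G * (1 + s ^ 2) := by
  obtain ⟨C, hC, hder⟩ := hφ.exists_deriv_sq_le hα hα1 hL
  obtain ⟨B, hB⟩ := hφ0
  have hA := stepConstA_pos hα hL
  set A := stepConstA α L
  refine ⟨max B 0 + (A * max B 0 + C) + 1 + L, by positivity, fun y s => ?_⟩
  have hB0 : φ y 0 ≤ max B 0 := (hB ⟨y, rfl⟩).trans (le_max_left _ _)
  have hm : (0 : ℝ) ≤ max B 0 := le_max_right _ _
  have h1 := hφ.le_descent y 0 s
  have h2 : deriv (φ y) 0 ^ 2 ≤ A * max B 0 + C :=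
    (hder y 0).trans (by nlinarith)
  have h3 : |s| ^ α * |s| ≤ 1 + s ^ 2 := by
    rw [← sq_abs s]
    rcases le_total |s| 1 with h | h
    · have := Real.rpow_le_one (abs_nonneg s) h hα.le
      nlinarith [abs_nonneg s]
    · have : |s| ^ α ≤ |s| := by simpa using Real.rpow_le_rpow_of_exponent_le h hα1
      nlinarith
  have h4 : L * |s| ^ α * |s| ≤ L * (1 + s ^ 2) := by
    rw [mul_assoc]; exact mul_le_mul_of_nonneg_left h3 hL.le
  simp only [sub_zero] at h1
  have hq : 0 ≤ A * max B 0 + C := by positivity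
  nlinarith [sq_nonneg (deriv (φ y) 0 - s), mul_nonneg hm (sq_nonneg s), mul_nonneg hq (sq_nonneg s),
    sq_nonneg s]

lemma IsHolderLoss.continuous_deriv (hφ : IsHolderLoss φ α L) (hα : 0 < α) (y : Y) :
    Continuous (deriv (φ y)) := by
  refine continuous_iff_continuousAt.2 fun s => ?_
  rw [ContinuousAt, tendsto_iff_dist_tendsto_zero]
  have hc : Continuous fun u : ℝ => L * |u - s| ^ α :=
    continuous_const.mul ((continuous_id.sub continuous_const).abs.rpow_const fun _ => Or.inr hα.le)
  have ht : Filter.Tendsto (fun u : ℝ => L * |u - s| ^ α) (nhds s) (nhds 0) := by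
    simpa [Real.zero_rpow hα.ne'] using hc.tendsto s
  exact squeeze_zero (fun _ => dist_nonneg) (fun u => hφ.holder y u s) ht

lemma IsHolderLoss.measurable_uncurry (hφ : IsHolderLoss φ α L) :
    Measurable fun p : ℝ × Y => φ p.2 p.1 :=
  measurable_uncurry_of_continuous_of_measurable (u := fun s y => φ y s)
    (fun y => (hφ.differentiable y).continuous) hφ.measurable

lemma IsHolderLoss.measurable_deriv_uncurry (hφ : IsHolderLoss φ α L) (hα : 0 < α) :
    Measurable fun p : ℝ × Y => deriv (φ p.2) p.1 := by
  refine measurable_uncurry_of_continuous_of_measurable (u := fun s y => deriv (φ y) s)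
    (fun y => hφ.continuous_deriv hα y) fun s => ?_
  -- In `y`, the derivative is a pointwise limit of measurable difference quotients.
  have hseq : Filter.Tendsto (fun n : ℕ => 1 / ((n : ℝ) + 1)) Filter.atTop (nhdsWithin 0 {0}ᶜ) :=
    tendsto_nhdsWithin_iff.2 ⟨tendsto_one_div_add_atTop_nhds_zero_nat,
      Filter.Eventually.of_forall fun n => by
        simp only [mem_compl_iff, mem_singleton_iff]; positivity⟩
  refine measurable_of_tendsto_metrizable
    (f := fun (n : ℕ) y => (1 / ((n : ℝ) + 1))⁻¹ • (φ y (s + 1 / ((n : ℝ) + 1)) - φ y s))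
    (fun n => ((hφ.measurable (s + 1 / ((n : ℝ) + 1))).sub (hφ.measurable s)).const_smul
      (1 / ((n : ℝ) + 1))⁻¹) ?_
  rw [tendsto_pi_nhds]
  intro y
  exact (hasDerivAt_iff_tendsto_slope_zero.1 (hφ.differentiable y s).hasDerivAt).comp hseq

end Loss

/-! ### A Bernstein-type inequality. -/

/-- A Bernstein-type bound for the moment generating function of an excess loss `g`, whose second
moment is controlled by its mean through `-h ≤ g`. -/
lemma lintegral_exp_neg_mul_le {S : Type*} [MeasurableSpace S] {ρ : Measure S}
    [IsProbabilityMeasure ρ] {g h : S → ℝ} {B G t : ℝ} (hg : Integrable g ρ)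
    (hB : ∀ z, h z ≤ B) (hgh : ∀ z, -h z ≤ g z) (hgG : ∀ z, |g z| ≤ G)
    (hmean : 0 ≤ ∫ z, g z ∂ρ) (ht : 0 ≤ t) (htG : t * G ≤ 1) (hh : ∀ z, 0 ≤ h z) :
    ∫⁻ z, ENNReal.ofReal (Real.exp (-(t * g z))) ∂ρ
      ≤ ENNReal.ofReal (Real.exp (2 * t ^ 2 * G * B)) := by
  have hG : ∀ z : S, 0 ≤ G := fun z => (abs_nonneg _).trans (hgG z)
  have hpt : ∀ z, Real.exp (-(t * g z))
      ≤ 1 + 2 * t ^ 2 * G * B - t * (1 - t * G) * g z := by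
    intro z
    have h1 : |-(t * g z)| ≤ 1 := by
      rw [abs_neg, abs_mul, abs_of_nonneg ht]
      exact (mul_le_mul_of_nonneg_left (hgG z) ht).trans htG
    have h2 := (abs_le.1 (Real.abs_exp_sub_one_sub_id_le h1)).2
    have h3 : |g z| ≤ g z + 2 * h z := by
      rw [abs_le]; constructor <;> linarith [hh z, hgh z]
    have h4 : g z ^ 2 ≤ G * (g z + 2 * B) := by
      rw [← sq_abs, sq]
      exact mul_le_mul (hgG z) (by linarith [hB z]) (abs_nonneg _) (hG z)
    -- This is `exp x ≤ 1 + x + x²` at `x = -t g`, with `g²` replaced by its bound linear in `g`.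
    nlinarith [mul_le_mul_of_nonneg_left h4 (sq_nonneg t)]
  have hint : Integrable (fun z => 1 + 2 * t ^ 2 * G * B - t * (1 - t * G) * g z) ρ :=
    (integrable_const _).sub (hg.const_mul _)
  calc ∫⁻ z, ENNReal.ofReal (Real.exp (-(t * g z))) ∂ρ
      ≤ ∫⁻ z, ENNReal.ofReal (1 + 2 * t ^ 2 * G * B - t * (1 - t * G) * g z) ∂ρ :=
        lintegral_mono fun z => ENNReal.ofReal_le_ofReal (hpt z)
    _ = ENNReal.ofReal (∫ z, (1 + 2 * t ^ 2 * G * B - t * (1 - t * G) * g z) ∂ρ) :=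
        (ofReal_integral_eq_lintegral_ofReal hint
          (Filter.Eventually.of_forall fun z => (Real.exp_nonneg _).trans (hpt z))).symm
    _ ≤ _ := by
        refine ENNReal.ofReal_le_ofReal ?_
        rw [integral_sub (integrable_const _) (hg.const_mul _), integral_const_mul]
        simp only [integral_const, probReal_univ, one_smul]
        have : 0 ≤ t * (1 - t * G) * ∫ z, g z ∂ρ :=
          mul_nonneg (mul_nonneg ht (by linarith)) hmean
        linarith [Real.add_one_le_exp (2 * t ^ 2 * G * B)]

/-! ### Kernel sections and pathwise bounds on the iterates. -/

section Kernel

variable {d : ℕ} {X : Set (EuclideanSpace ℝ (Fin d))} {Y : Set ℝ}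
  {H : Type*} [NormedAddCommGroup H] [InnerProductSpace ℝ H] [CompleteSpace H] [RKHS ℝ H X ℝ]
  {φ : Y → ℝ → ℝ} {α L : ℝ} {η : ℕ → ℝ}

lemma inner_kerSection_left (x : X) (f : H) : inner ℝ (kerSection H x) f = f x := by
  simp [kerSection]

lemma realKernel_eq_inner (x x' : X) :
    realKernel H x x' = inner ℝ (kerSection H x) (kerSection H x') := by
  rw [inner_kerSection_left, kerSection, RKHS.kerFun_apply, realKernel]

lemma realKernel_self (x : X) : realKernel H x x = ‖kerSection H x‖ ^ 2 := by
  rw [realKernel_eq_inner, real_inner_self_eq_norm_sq]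

lemma norm_kerSection_le (hκ : BddAbove (range fun x : X => √(realKernel H x x))) (x : X) :
    ‖kerSection H x‖ ≤ kernelBound H := by
  have := le_ciSup hκ x
  simpa only [realKernel_self, Real.sqrt_sq (norm_nonneg _), kernelBound] using this

lemma norm_kerSection_sq_le (hκ : BddAbove (range fun x : X => √(realKernel H x x))) (x : X) :
    ‖kerSection H x‖ ^ 2 ≤ kernelBound H ^ 2 :=
  pow_le_pow_left₀ (norm_nonneg _) (norm_kerSection_le hκ x) 2

lemma sq_apply_le (hκ : BddAbove (range fun x : X => √(realKernel H x x))) (f : H) (x : X) :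
    f x ^ 2 ≤ kernelBound H ^ 2 * ‖f‖ ^ 2 := by
  rw [← inner_kerSection_left, ← sq_abs]
  calc |inner ℝ (kerSection H x) f| ^ 2 ≤ (‖kerSection H x‖ * ‖f‖) ^ 2 :=
        pow_le_pow_left₀ (abs_nonneg _) (abs_real_inner_le_norm _ _) 2
    _ = ‖kerSection H x‖ ^ 2 * ‖f‖ ^ 2 := mul_pow _ _ _
    _ ≤ _ := mul_le_mul_of_nonneg_right (norm_kerSection_sq_le hκ x) (sq_nonneg _)

/-- Expand `‖K_u - K_x‖²` by the kernel. As `X` is second countable, this gives strong measurability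
without assuming `H` separable. -/
lemma continuous_kerSection (hK : Continuous fun p : X × X => realKernel H p.1 p.2) :
    Continuous (kerSection H : X → H) := by
  refine continuous_iff_continuousAt.2 fun x => ?_
  rw [ContinuousAt, tendsto_iff_norm_sub_tendsto_zero]
  have hc : Continuous fun u : X =>
      √(realKernel H u u - 2 * realKernel H u x + realKernel H x x) :=
    Real.continuous_sqrt.comp (((hK.comp (continuous_id.prodMk continuous_id)).sub
      (continuous_const.mul (hK.comp (continuous_id.prodMk continuous_const)))).add
      continuous_const)
  have ht := hc.tendsto x
  rw [show realKernel H x x - 2 * realKernel H x x + realKernel H x x = 0 by ring,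
    Real.sqrt_zero] at ht
  refine ht.congr fun u => ?_
  rw [realKernel_self, realKernel_self, realKernel_eq_inner, ← norm_sub_sq_real,
    Real.sqrt_sq (norm_nonneg _)]

lemma measurable_coe (hK : Continuous fun p : X × X => realKernel H p.1 p.2) (f : H) :
    Measurable fun x : X => f x := by
  simp_rw [← inner_kerSection_left]
  exact ((continuous_kerSection hK).inner continuous_const).measurable

lemma measurable_loss_coe (hK : Continuous fun p : X × X => realKernel H p.1 p.2)
    (hφ : IsHolderLoss φ α L) (f : H) :
    Measurable fun z : X × Y => φ z.2 (f z.1) :=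
  hφ.measurable_uncurry.comp (((measurable_coe hK f).comp measurable_fst).prodMk measurable_snd)

/-- The effect of one gradient step on the distance to `u`. -/
lemma norm_gradient_step_sub_sq_le (hκ : BddAbove (range fun x : X => √(realKernel H x x)))
    (hφ : IsHolderLoss φ α L) {A C e : ℝ}
    (hder : ∀ y s, deriv (φ y) s ^ 2 ≤ A * φ y s + C) (he : 0 ≤ e) (f u : H) (z : X × Y) :
    ‖f - (e * deriv (φ z.2) (f z.1)) • kerSection H z.1 - u‖ ^ 2
      ≤ ‖f - u‖ ^ 2 - e * (2 - A * kernelBound H ^ 2 * e) * (φ z.2 (f z.1) - φ z.2 (u z.1))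
        + e ^ 2 * kernelBound H ^ 2 * (A * φ z.2 (u z.1) + C) := by
  set g := deriv (φ z.2) (f z.1) with hg
  have h1 : ‖f - (e * g) • kerSection H z.1 - u‖ ^ 2
      = ‖f - u‖ ^ 2 - 2 * e * (g * (f z.1 - u z.1)) + e ^ 2 * (g ^ 2 * ‖kerSection H z.1‖ ^ 2) := by
    rw [sub_right_comm, norm_sub_sq_real, inner_smul_right, real_inner_comm,
      inner_kerSection_left, norm_smul, RKHS.coe_sub, Pi.sub_apply, mul_pow, Real.norm_eq_abs,
      sq_abs]
    ring
  have h2 := hφ.tangent_le z.2 (f z.1) (u z.1)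
  rw [← hg] at h2
  have h3 : g ^ 2 * ‖kerSection H z.1‖ ^ 2 ≤ (A * φ z.2 (f z.1) + C) * kernelBound H ^ 2 :=
    mul_le_mul (hder _ _) (norm_kerSection_sq_le hκ _) (sq_nonneg _)
      ((sq_nonneg _).trans (hder z.2 (f z.1)))
  rw [h1]
  nlinarith [mul_le_mul_of_nonneg_left h3 (sq_nonneg e), mul_le_mul_of_nonneg_left h2 he]

lemma norm_ogd_sq_le (hκ : BddAbove (range fun x : X => √(realKernel H x x)))
    (hφ : IsHolderLoss φ α L) {A C B : ℝ} (hC : 0 ≤ C)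
    (hder : ∀ y s, deriv (φ y) s ^ 2 ≤ A * φ y s + C) (hB : ∀ y, φ y 0 ≤ B)
    (hη : ∀ n, 0 < η n) (hηA : ∀ n, A * kernelBound H ^ 2 * η n ≤ 1) (hanti : Antitone η)
    (z : ℕ → X × Y) (n : ℕ) :
    ‖ogd H φ η z n‖ ^ 2
      ≤ (2 * B + η 0 * (kernelBound H ^ 2 * C)) * ∑ k ∈ Finset.range n, η k := by
  induction n with
  | zero => simp [ogd]
  | succ n ih =>
    have h := norm_gradient_step_sub_sq_le hκ hφ hder (hη n).le (ogd H φ η z n) 0 (z n)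
    simp only [sub_zero, RKHS.coe_zero, Pi.zero_apply] at h
    rw [Finset.sum_range_succ, mul_add, ogd]
    have h0 := hφ.nonneg (z n).2 ((ogd H φ η z n : H) (z n).1)
    have h1 : 0 ≤ η n * (2 - A * kernelBound H ^ 2 * η n) :=
      mul_nonneg (hη n).le (by linarith [hηA n])
    have h2 := mul_nonneg h1 h0
    have h3 : η n * (η n * (kernelBound H ^ 2 * C)) ≤ η n * (η 0 * (kernelBound H ^ 2 * C)) :=
      mul_le_mul_of_nonneg_left (mul_le_mul_of_nonneg_right (hanti n.zero_le) (by positivity))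
        (hη n).le
    -- The two terms in `φ (y, 0)` add up to exactly `2 η_n φ (y, 0)`.
    have h4 := mul_le_mul_of_nonneg_left (hB (z n).2) (hη n).le
    linarith

/-- For decreasing steps `η_n η_k ≤ η_k²` when `k < n`, so the growth of `‖f_n‖²` like `∑ η_k`
becomes a bound by `∑ η_k²`. -/
lemma mul_norm_ogd_sq_le (hκ : BddAbove (range fun x : X => √(realKernel H x x)))
    (hφ : IsHolderLoss φ α L) {A C B : ℝ} (hC : 0 ≤ C) (hB0 : 0 ≤ B)
    (hder : ∀ y s, deriv (φ y) s ^ 2 ≤ A * φ y s + C) (hB : ∀ y, φ y 0 ≤ B)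
    (hη : ∀ n, 0 < η n) (hηA : ∀ n, A * kernelBound H ^ 2 * η n ≤ 1) (hanti : Antitone η)
    (hsum : Summable fun n => η n ^ 2) (z : ℕ → X × Y) (n : ℕ) :
    η n * ‖ogd H φ η z n‖ ^ 2
      ≤ (2 * B + η 0 * (kernelBound H ^ 2 * C)) * ∑' k, η k ^ 2 := by
  have h := norm_ogd_sq_le hκ hφ hC hder hB hη hηA hanti z n
  have hc : 0 ≤ 2 * B + η 0 * (kernelBound H ^ 2 * C) := by have := hη 0; positivity
  calc η n * ‖ogd H φ η z n‖ ^ 2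
      ≤ η n * ((2 * B + η 0 * (kernelBound H ^ 2 * C)) * ∑ k ∈ Finset.range n, η k) :=
        mul_le_mul_of_nonneg_left h (hη n).le
    _ = (2 * B + η 0 * (kernelBound H ^ 2 * C)) * ∑ k ∈ Finset.range n, η n * η k := by
        rw [← Finset.mul_sum]; ring
    _ ≤ (2 * B + η 0 * (kernelBound H ^ 2 * C)) * ∑ k ∈ Finset.range n, η k ^ 2 := by
        refine mul_le_mul_of_nonneg_left (Finset.sum_le_sum fun k hk => ?_) hc
        rw [sq]
        exact mul_le_mul_of_nonneg_right (hanti (Finset.mem_range.1 hk).le) (hη k).le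
    _ ≤ _ := mul_le_mul_of_nonneg_left
        (hsum.sum_le_tsum _ fun k _ => sq_nonneg _) hc

/-! ### Measurability of the iterates and conditioning on the past. -/

lemma ogd_congr {z z' : ℕ → X × Y} {n : ℕ} (h : ∀ k < n, z k = z' k) :
    ogd H φ η z n = ogd H φ η z' n := by
  induction n with
  | zero => rfl
  | succ n ih => rw [ogd, ogd, ih fun k hk => h k (hk.trans n.lt_succ_self), h n n.lt_succ_self]

/-- A gradient step depends measurably on the current iterate and the example. -/
lemma stronglyMeasurable_gradient_step {S : Type*} [MeasurableSpace S]
    (hK : Continuous fun p : X × X => realKernel H p.1 p.2)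
    (hφ : IsHolderLoss φ α L) (hα : 0 < α) (e : ℝ) {f : S → H} (hf : StronglyMeasurable f)
    {z : S → X × Y} (hz : Measurable z) :
    StronglyMeasurable fun s =>
      f s - (e * deriv (φ (z s).2) (f s (z s).1)) • kerSection H (z s).1 := by
  have hker : StronglyMeasurable fun s => kerSection H (z s).1 :=
    (continuous_kerSection hK).stronglyMeasurable.comp_measurable hz.fst
  have heval : Measurable fun s => f s (z s).1 := by
    simp_rw [← inner_kerSection_left]
    exact (hker.inner hf).measurable
  have hder : Measurable fun s => deriv (φ (z s).2) (f s (z s).1) :=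
    (hφ.measurable_deriv_uncurry hα).comp (heval.prodMk hz.snd)
  exact hf.sub ((hder.const_mul e).stronglyMeasurable.smul hker)

lemma stronglyMeasurable_ogd (hK : Continuous fun p : X × X => realKernel H p.1 p.2)
    (hφ : IsHolderLoss φ α L) (hα : 0 < α) (n : ℕ) :
    StronglyMeasurable fun z : ℕ → X × Y => ogd H φ η z n := by
  induction n with
  | zero => exact stronglyMeasurable_const
  | succ n ih =>
    exact stronglyMeasurable_gradient_step hK hφ hα (η n) ih (measurable_pi_apply n)

/-- Conditioning on the first `n` examples: a bound for the expectation over a fresh example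
integrates to a bound for the iterates. -/
lemma lintegral_ogd_le {Ω : Type*} [MeasurableSpace Ω] {P : Measure Ω} [IsProbabilityMeasure P]
    {ρ : Measure (X × Y)} [IsProbabilityMeasure ρ]
    (hK : Continuous fun p : X × X => realKernel H p.1 p.2)
    (hφ : IsHolderLoss φ α L) (hα : 0 < α) {Z : ℕ → Ω → X × Y} (hZ : ∀ n, Measurable (Z n))
    (hlaw : ∀ n, P.map (Z n) = ρ) (hind : iIndepFun Z P) (n : ℕ)
    {F F' : H → ENNReal} (hF : Continuous F) (hF' : Continuous F')
    (hstep : ∀ z : ℕ → X × Y, ∫⁻ w, F' (ogd H φ η z n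
      - (η n * deriv (φ w.2) ((ogd H φ η z n : H) w.1)) • kerSection H w.1) ∂ρ
        ≤ F (ogd H φ η z n)) :
    ∫⁻ ω, F' (ogd H φ η (fun k => Z k ω) (n + 1)) ∂P
      ≤ ∫⁻ ω, F (ogd H φ η (fun k => Z k ω) n) ∂P := by
  obtain ⟨z₀⟩ : Nonempty (X × Y) := nonempty_of_isProbabilityMeasure ρ
  -- Padding a finite history by `z₀` does not affect iterate `n`, which uses only examples of index
  -- below `n`; it is thus a function of `pre`, independent of `Z n`.
  let ext : (Finset.range n → X × Y) → ℕ → X × Y :=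
    fun v k => if h : k ∈ Finset.range n then v ⟨k, h⟩ else z₀
  have hext : Measurable ext := measurable_pi_iff.2 fun k => by
    by_cases h : k ∈ Finset.range n
    · simpa only [ext, dif_pos h] using measurable_pi_apply _
    · simpa only [ext, dif_neg h] using measurable_const
  let pre : Ω → Finset.range n → X × Y := fun ω k => Z k ω
  have hpre : Measurable pre := measurable_pi_iff.2 fun k => hZ k
  have hogd : ∀ ω, ogd H φ η (ext (pre ω)) n = ogd H φ η (fun k => Z k ω) n := fun ω =>
    ogd_congr fun k hk => by simp [ext, pre, hk]
  have hindep : IndepFun pre (Z n) P :=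
    (hind.indepFun_finset (Finset.range n) {n} (by simp) hZ).comp measurable_id
      (measurable_pi_apply (⟨n, by simp⟩ : ({n} : Finset ℕ)))
  have hmap : P.map (fun ω => (pre ω, Z n ω)) = (P.map pre).prod ρ := by
    rw [(indepFun_iff_map_prod_eq_prod_map_map hpre.aemeasurable (hZ n).aemeasurable).1 hindep,
      hlaw]
  have hf : StronglyMeasurable fun v => ogd H φ η (ext v) n :=
    (stronglyMeasurable_ogd hK hφ hα n).comp_measurable hext
  have hψ : Measurable fun p : (Finset.range n → X × Y) × (X × Y) => F' (ogd H φ η (ext p.1) n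
      - (η n * deriv (φ p.2.2) ((ogd H φ η (ext p.1) n : H) p.2.1)) • kerSection H p.2.1) :=
    (hF'.comp_stronglyMeasurable (stronglyMeasurable_gradient_step hK hφ hα (η n)
      (hf.comp_measurable measurable_fst) measurable_snd)).measurable
  have hFm : Measurable fun v => F (ogd H φ η (ext v) n) :=
    (hF.comp_stronglyMeasurable hf).measurable
  calc ∫⁻ ω, F' (ogd H φ η (fun k => Z k ω) (n + 1)) ∂P
      = ∫⁻ ω, (fun p : (Finset.range n → X × Y) × (X × Y) => F' (ogd H φ η (ext p.1) n
          - (η n * deriv (φ p.2.2) ((ogd H φ η (ext p.1) n : H) p.2.1)) • kerSection H p.2.1))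
            (pre ω, Z n ω) ∂P := by
        simp only [hogd, ogd]
    _ = ∫⁻ p, F' (ogd H φ η (ext p.1) n
          - (η n * deriv (φ p.2.2) ((ogd H φ η (ext p.1) n : H) p.2.1)) • kerSection H p.2.1)
            ∂((P.map pre).prod ρ) := by
        rw [← hmap, lintegral_map hψ (hpre.prodMk (hZ n))]
    _ = ∫⁻ v, ∫⁻ w, F' (ogd H φ η (ext v) n
          - (η n * deriv (φ w.2) ((ogd H φ η (ext v) n : H) w.1)) • kerSection H w.1) ∂ρ
            ∂(P.map pre) := lintegral_prod _ hψ.aemeasurable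
    _ ≤ ∫⁻ v, F (ogd H φ η (ext v) n) ∂(P.map pre) := lintegral_mono fun v => hstep (ext v)
    _ = ∫⁻ ω, F (ogd H φ η (fun k => Z k ω) n) ∂P := by
        rw [lintegral_map hFm hpre]
        simp only [hogd]

end Kernel

/-! ### Exponential moments of the distance to the minimizer. -/

/-- The variance term of a step, in terms of the distance to the minimizer. -/
lemma mgf_exponent_le {E : Type*} [SeminormedAddCommGroup E] (f u : E) {l μ e G B : ℝ}
    (hl : 0 ≤ l) (hl1 : l ≤ 1) (hμ0 : 0 ≤ μ) (hμe : μ ≤ 2 * e) (hG : 0 ≤ G) (hB : 0 ≤ B) :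
    2 * (l * μ) ^ 2 * (G * (1 + ‖f‖ ^ 2)) * B
      ≤ l * (16 * G * B * (1 + ‖u‖ ^ 2) * e ^ 2 * (1 + ‖f - u‖ ^ 2)) := by
  have h1 : (l * μ) ^ 2 ≤ l * (4 * e ^ 2) := by
    have h2 : μ ^ 2 ≤ (2 * e) ^ 2 := pow_le_pow_left₀ hμ0 hμe 2
    have h3 : l ^ 2 ≤ l := by nlinarith
    calc (l * μ) ^ 2 = l ^ 2 * μ ^ 2 := mul_pow _ _ _
      _ ≤ l * (2 * e) ^ 2 := mul_le_mul h3 h2 (sq_nonneg _) hl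
      _ = _ := by ring
  have hf : ‖f‖ ^ 2 ≤ 2 * ‖f - u‖ ^ 2 + 2 * ‖u‖ ^ 2 := by
    have h2 : ‖f‖ ≤ ‖f - u‖ + ‖u‖ := by
      simpa only [sub_add_cancel] using norm_add_le (f - u) u
    have h3 := pow_le_pow_left₀ (norm_nonneg _) h2 2
    nlinarith [sq_nonneg (‖f - u‖ - ‖u‖)]
  set D := ‖f - u‖ ^ 2
  have hD0 : 0 ≤ D := sq_nonneg _
  have h4 : 1 + ‖f‖ ^ 2 ≤ 2 * ((1 + ‖u‖ ^ 2) * (1 + D)) := by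
    nlinarith [mul_nonneg hD0 (sq_nonneg ‖u‖)]
  calc 2 * (l * μ) ^ 2 * (G * (1 + ‖f‖ ^ 2)) * B
      = 2 * G * B * ((l * μ) ^ 2 * (1 + ‖f‖ ^ 2)) := by ring
    _ ≤ 2 * G * B * (l * (4 * e ^ 2) * (2 * ((1 + ‖u‖ ^ 2) * (1 + D)))) :=
        mul_le_mul_of_nonneg_left (mul_le_mul h1 h4 (by positivity) (by positivity))
          (by positivity)
    _ = _ := by ring

section Kernel

variable {d : ℕ} {X : Set (EuclideanSpace ℝ (Fin d))} {Y : Set ℝ}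
  {H : Type*} [NormedAddCommGroup H] [InnerProductSpace ℝ H] [CompleteSpace H] [RKHS ℝ H X ℝ]
  {φ : Y → ℝ → ℝ} {α L : ℝ} {η : ℕ → ℝ}

/-- The exponential moment of the squared distance to the minimizer after one step from an iterate,
over a fresh example. -/
lemma exists_lintegral_exp_step_le (ρ : Measure (X × Y)) [IsProbabilityMeasure ρ]
    (hK : Continuous fun p : X × X => realKernel H p.1 p.2)
    (hκ : BddAbove (range fun x : X => √(realKernel H x x)))
    (hα : 0 < α) (hα1 : α ≤ 1) (hL : 0 < L) (hφ : IsHolderLoss φ α L)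
    (hφ0 : BddAbove (range fun y : Y => φ y 0))
    (fH : H) (hfH : IsMinOn (fun f : H => genError ρ φ f) univ fH)
    (hφH : BddAbove (range fun z : X × Y => φ z.2 (fH z.1)))
    (hη : ∀ n, 0 < η n) (hηA : ∀ n, stepConstA α L * kernelBound H ^ 2 * η n ≤ 1)
    (hanti : Antitone η) (hsum : Summable fun n => η n ^ 2) :
    ∃ c l₀ : ℝ, 0 ≤ c ∧ 0 < l₀ ∧ ∀ (z : ℕ → X × Y) (n : ℕ) (l : ℝ), 0 ≤ l → l ≤ l₀ →
      ∫⁻ w, ENNReal.ofReal (Real.exp (l * ‖ogd H φ η z n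
        - (η n * deriv (φ w.2) ((ogd H φ η z n : H) w.1)) • kerSection H w.1 - fH‖ ^ 2)) ∂ρ
      ≤ ENNReal.ofReal (Real.exp (l * (‖ogd H φ η z n - fH‖ ^ 2
        + c * η n ^ 2 * (1 + ‖ogd H φ η z n - fH‖ ^ 2)))) := by
  obtain ⟨C, hC, hder⟩ := hφ.exists_deriv_sq_le hα hα1 hL
  obtain ⟨G, hG, hquad⟩ := hφ.exists_le_quadratic hα hα1 hL hφ0
  obtain ⟨b, hb⟩ := hφH
  have hA := stepConstA_pos hα hL
  set A := stepConstA α L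
  set k := kernelBound H ^ 2 with hk
  have hk0 : 0 ≤ k := sq_nonneg _
  set B := max b 0
  have hB0 : 0 ≤ B := le_max_right _ _
  have hB : ∀ w : X × Y, φ w.2 (fH w.1) ≤ B := fun w => (hb ⟨w, rfl⟩).trans (le_max_left _ _)
  set R := (2 * G + η 0 * (k * C)) * ∑' j, η j ^ 2
  have hS : 0 ≤ ∑' j, η j ^ 2 := tsum_nonneg fun j => sq_nonneg _
  have hη0 := hη 0
  have hR : 0 ≤ R := by positivity
  have hηf : ∀ z n, η n * ‖ogd H φ η z n‖ ^ 2 ≤ R := fun z n =>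
    mul_norm_ogd_sq_le hκ hφ hC hG hder (fun y => by simpa using hquad y 0) hη hηA hanti hsum z n
  set G' := G * (1 + k) + B with hG'
  have hG'0 : 0 ≤ G' := by positivity
  -- A bound, uniform in `n`, for `μ_n` times the range of the excess loss.
  set q := 2 * G' * (η 0 + R) with hq
  have hq0 : 0 ≤ q := by positivity
  have hgrow : ∀ (f : H) (w : X × Y), φ w.2 (f w.1) ≤ G' * (1 + ‖f‖ ^ 2) := fun f w => by
    have h1 := hquad w.2 (f w.1)
    have h2 := mul_le_mul_of_nonneg_left (sq_apply_le hκ f w.1) hG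
    rw [← hk] at h2
    nlinarith [sq_nonneg ‖f‖, mul_nonneg hG (sq_nonneg ‖f‖), mul_nonneg hG hk0,
      mul_nonneg hB0 (sq_nonneg ‖f‖)]
  have hint : ∀ f : H, Integrable (fun w : X × Y => φ w.2 (f w.1)) ρ := fun f =>
    .of_bound (measurable_loss_coe hK hφ f).aestronglyMeasurable (G' * (1 + ‖f‖ ^ 2))
      (Filter.Eventually.of_forall fun w => by
        rw [Real.norm_of_nonneg (hφ.nonneg _ _)]; exact hgrow f w)
  -- The two summands come from the squared gradient and from the variance. The `+ 1` in `q + 1`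
  -- also yields `l ≤ 1`, so that `l² ≤ l`.
  refine ⟨k * (A * B + C) + 16 * G' * B * (1 + ‖fH‖ ^ 2), 1 / (q + 1), by positivity,
    by positivity, fun z n l hl hl₀ => ?_⟩
  set f := ogd H φ η z n
  have he := hη n
  set e := η n
  set D := ‖f - fH‖ ^ 2 with hD
  set μ := e * (2 - A * k * e) with hμ
  have hAke : 0 ≤ A * k * e := by positivity
  have hμ0 : 0 ≤ μ := mul_nonneg he.le (by linarith [hηA n])
  have hμe : μ ≤ 2 * e := by nlinarith
  have hql : l * (q + 1) ≤ 1 := by rwa [← le_div_iff₀ (by positivity)]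
  have hlq : l * q ≤ 1 := by nlinarith
  have hl1 : l ≤ 1 := by nlinarith [mul_nonneg hl hq0]
  have hμG : μ * (G' * (1 + ‖f‖ ^ 2)) ≤ q := by
    have h1 : e * (1 + ‖f‖ ^ 2) ≤ η 0 + R := by
      have := hηf z n
      have := hanti n.zero_le
      simp only [e, f] at *
      linarith
    calc μ * (G' * (1 + ‖f‖ ^ 2)) ≤ 2 * e * (G' * (1 + ‖f‖ ^ 2)) :=
          mul_le_mul_of_nonneg_right hμe (by positivity)
      _ = 2 * G' * (e * (1 + ‖f‖ ^ 2)) := by ring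
      _ ≤ q := mul_le_mul_of_nonneg_left h1 (by positivity)
  have hmgf := lintegral_exp_neg_mul_le (ρ := ρ) (t := l * μ) (B := B)
    (g := fun w : X × Y => φ w.2 (f w.1) - φ w.2 (fH w.1)) (h := fun w => φ w.2 (fH w.1))
    (G := G' * (1 + ‖f‖ ^ 2)) ((hint f).sub (hint fH)) hB
    (fun w => by linarith [hφ.nonneg w.2 (f w.1)])
    (fun w => by
      have h1 : B ≤ G' * (1 + ‖f‖ ^ 2) := by
        have : B ≤ G' := by rw [hG']; linarith [mul_nonneg hG (by linarith : 0 ≤ 1 + k)]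
        nlinarith [mul_nonneg hG'0 (sq_nonneg ‖f‖)]
      rw [abs_le]
      constructor <;>
        linarith [hB w, hgrow f w, hφ.nonneg w.2 (f w.1), hφ.nonneg w.2 (fH w.1)])
    (by
      rw [integral_sub (hint f) (hint fH)]
      exact sub_nonneg.2 (hfH (mem_univ f)))
    (mul_nonneg hl hμ0)
    (by
      rw [mul_assoc]
      exact (mul_le_mul_of_nonneg_left hμG hl).trans hlq)
    (fun w => hφ.nonneg _ _)
  have hpt : ∀ w : X × Y, ENNReal.ofReal (Real.exp (l * ‖f
        - (e * deriv (φ w.2) (f w.1)) • kerSection H w.1 - fH‖ ^ 2))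
      ≤ ENNReal.ofReal (Real.exp (l * (D + e ^ 2 * (k * (A * B + C)))))
        * ENNReal.ofReal (Real.exp (-(l * μ * (φ w.2 (f w.1) - φ w.2 (fH w.1))))) := fun w => by
    rw [← ENNReal.ofReal_mul (Real.exp_nonneg _), ← Real.exp_add]
    refine ENNReal.ofReal_le_ofReal (Real.exp_le_exp.2 ?_)
    have h1 := norm_gradient_step_sub_sq_le hκ hφ hder he.le f fH w
    rw [← hk, ← hμ, ← hD] at h1
    have h2 : e ^ 2 * k * (A * φ w.2 (fH w.1) + C) ≤ e ^ 2 * k * (A * B + C) :=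
      mul_le_mul_of_nonneg_left (by linarith [mul_le_mul_of_nonneg_left (hB w) hA.le])
        (by positivity)
    have h3 := mul_le_mul_of_nonneg_left (h1.trans (add_le_add_right h2 _)) hl
    linarith
  refine (lintegral_mono hpt).trans ?_
  rw [lintegral_const_mul' _ _ ENNReal.ofReal_ne_top]
  refine (mul_le_mul_right hmgf _).trans ?_
  rw [← ENNReal.ofReal_mul (Real.exp_nonneg _), ← Real.exp_add]
  refine ENNReal.ofReal_le_ofReal (Real.exp_le_exp.2 ?_)
  have h5 : 2 * (l * μ) ^ 2 * (G' * (1 + ‖f‖ ^ 2)) * B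
      ≤ l * (16 * G' * B * (1 + ‖fH‖ ^ 2) * e ^ 2 * (1 + D)) :=
    mgf_exponent_le f fH hl hl1 hμ0 hμe hG'0 hB0
  have hD0 : 0 ≤ D := sq_nonneg _
  have h6 : 0 ≤ l * (e ^ 2 * (k * (A * B + C)) * D) := by positivity
  linarith

/-- Along the iterates, some exponential moment of the squared distance to the minimizer stays
bounded. -/
lemma exists_lintegral_exp_ogd_le (ρ : Measure (X × Y)) [IsProbabilityMeasure ρ]
    (hK : Continuous fun p : X × X => realKernel H p.1 p.2)
    (hκ : BddAbove (range fun x : X => √(realKernel H x x)))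
    (hα : 0 < α) (hα1 : α ≤ 1) (hL : 0 < L) (hφ : IsHolderLoss φ α L)
    (hφ0 : BddAbove (range fun y : Y => φ y 0))
    (fH : H) (hfH : IsMinOn (fun f : H => genError ρ φ f) univ fH)
    (hφH : BddAbove (range fun z : X × Y => φ z.2 (fH z.1)))
    (hη : ∀ n, 0 < η n) (hηA : ∀ n, stepConstA α L * kernelBound H ^ 2 * η n ≤ 1)
    (hanti : Antitone η) (hsum : Summable fun n => η n ^ 2) :
    ∃ M l : ℝ, 0 ≤ M ∧ 0 < l ∧
      ∀ (Ω : Type*) [MeasurableSpace Ω] (P : Measure Ω) [IsProbabilityMeasure P]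
        (Z : ℕ → Ω → X × Y), (∀ n, Measurable (Z n)) → (∀ n, P.map (Z n) = ρ) → iIndepFun Z P →
      ∀ n, ∫⁻ ω, ENNReal.ofReal (Real.exp (l * ‖ogd H φ η (fun k => Z k ω) n - fH‖ ^ 2)) ∂P
        ≤ ENNReal.ofReal (Real.exp M) := by
  obtain ⟨c, l₀, hc, hl₀, hstep⟩ := exists_lintegral_exp_step_le ρ hK hκ hα hα1 hL hφ hφ0 fH hfH
    hφH hη hηA hanti hsum
  have hS : 0 ≤ ∑' j, η j ^ 2 := tsum_nonneg fun j => sq_nonneg _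
  have hSle : ∀ n, ∑ j ∈ Finset.range n, η j ^ 2 ≤ ∑' j, η j ^ 2 := fun n =>
    hsum.sum_le_tsum _ fun k _ => sq_nonneg _
  refine ⟨l₀ * (‖fH‖ ^ 2 + c * ∑' j, η j ^ 2), l₀ * Real.exp (-(c * ∑' j, η j ^ 2)),
    by positivity, by positivity, fun Ω _ P _ Z hZ hlaw hind n => ?_⟩
  -- Decreasing weights that absorb the factors `1 + c η_n²`, yet stay above the positive `l` chosen
  -- as witness.
  set s : ℕ → ℝ := fun n => l₀ * Real.exp (-(c * ∑ j ∈ Finset.range n, η j ^ 2)) with hs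
  have hs0 : ∀ n, 0 ≤ s n := fun n => by positivity
  have hsl : ∀ n, s n ≤ l₀ := fun n => by
    refine mul_le_of_le_one_right hl₀.le (Real.exp_le_one_iff.2 ?_)
    have : 0 ≤ ∑ j ∈ Finset.range n, η j ^ 2 := Finset.sum_nonneg fun j _ => sq_nonneg _
    exact neg_nonpos.2 (mul_nonneg hc this)
  have hsucc : ∀ n, s (n + 1) * (1 + c * η n ^ 2) ≤ s n := fun n => by
    have h1 := Real.add_one_le_exp (c * η n ^ 2)
    have h2 : s n = s (n + 1) * Real.exp (c * η n ^ 2) := by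
      simp only [hs]
      rw [mul_assoc, ← Real.exp_add, Finset.sum_range_succ]
      congr 2
      ring
    rw [h2]
    exact mul_le_mul_of_nonneg_left (by linarith) (hs0 _)
  have key : ∀ n, ∫⁻ ω, ENNReal.ofReal
      (Real.exp (s n * ‖ogd H φ η (fun k => Z k ω) n - fH‖ ^ 2)) ∂P
      ≤ ENNReal.ofReal
        (Real.exp (l₀ * (‖fH‖ ^ 2 + c * ∑ j ∈ Finset.range n, η j ^ 2))) := by
    intro n
    induction n with
    | zero => simp [ogd, hs]
    | succ n ih =>
      have h := lintegral_ogd_le (P := P) (ρ := ρ) (η := η) hK hφ hα hZ hlaw hind n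
        (F := fun f => ENNReal.ofReal (Real.exp (l₀ * (c * η n ^ 2)))
          * ENNReal.ofReal (Real.exp (s n * ‖f - fH‖ ^ 2)))
        (F' := fun f => ENNReal.ofReal (Real.exp (s (n + 1) * ‖f - fH‖ ^ 2)))
        (ENNReal.continuous_const_mul ENNReal.ofReal_ne_top |>.comp
          (ENNReal.continuous_ofReal.comp (by fun_prop)))
        (ENNReal.continuous_ofReal.comp (by fun_prop))
        (fun z => by
          refine (hstep z n (s (n + 1)) (hs0 _) (hsl _)).trans ?_
          rw [← ENNReal.ofReal_mul (Real.exp_nonneg _), ← Real.exp_add]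
          refine ENNReal.ofReal_le_ofReal (Real.exp_le_exp.2 ?_)
          have h1 := mul_le_mul_of_nonneg_right (hsucc n) (sq_nonneg ‖ogd H φ η z n - fH‖)
          have h2 := mul_le_mul_of_nonneg_right (hsl (n + 1))
            (mul_nonneg hc (sq_nonneg (η n)))
          linarith)
      refine h.trans ?_
      rw [lintegral_const_mul' _ _ ENNReal.ofReal_ne_top]
      refine (mul_le_mul_right ih _).trans (le_of_eq ?_)
      rw [← ENNReal.ofReal_mul (Real.exp_nonneg _), ← Real.exp_add, Finset.sum_range_succ]
      congr 2
      ring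
  refine (lintegral_mono fun ω => ENNReal.ofReal_le_ofReal (Real.exp_le_exp.2 ?_)).trans
    ((key n).trans (ENNReal.ofReal_le_ofReal (Real.exp_le_exp.2 ?_)))
  · refine mul_le_mul_of_nonneg_right (mul_le_mul_of_nonneg_left (Real.exp_le_exp.2 ?_) hl₀.le)
      (sq_nonneg _)
    exact neg_le_neg (mul_le_mul_of_nonneg_left (hSle n) hc)
  · exact mul_le_mul_of_nonneg_left
      (add_le_add_right (mul_le_mul_of_nonneg_left (hSle n) hc) _) hl₀.le

end Kernel

/-! ### From exponential moments to a simultaneous tail bound. -/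

/-- A uniform bound on an exponential moment of each of `T` nonnegative quantities bounds them
simultaneously, at the cost of a factor `log (T / δ)`. -/
lemma le_measure_forall_le_mul_log {Ω : Type*} [MeasurableSpace Ω] (P : Measure Ω)
    [IsProbabilityMeasure P] {M l C : ℝ} (hM : 0 ≤ M) (hl : 0 < l)
    (hC : (1 + M / Real.log 2) / l ≤ C) (D : ℕ → Ω → ℝ)
    (hD : ∀ n, ∫⁻ ω, ENNReal.ofReal (Real.exp (l * D n ω)) ∂P ≤ ENNReal.ofReal (Real.exp M))
    (hDm : ∀ n, Measurable (D n)) {T : ℕ} {δ : ℝ} (hT : 1 ≤ T) (hδ : 0 < δ) (hTδ : 2 * δ ≤ T) :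
    ENNReal.ofReal (1 - δ) ≤ P {ω | ∀ n < T, D n ω ≤ C * Real.log (T / δ)} := by
  have hT0 : (0 : ℝ) < T := by exact_mod_cast hT
  have hlog2 : 0 < Real.log 2 := Real.log_pos one_lt_two
  have hlog : Real.log 2 ≤ Real.log (T / δ) :=
    Real.log_le_log two_pos ((le_div_iff₀ hδ).2 hTδ)
  -- Here `T ≥ 2δ` matters: `log (T / δ) ≥ log 2` lets the constant `M` be absorbed into a multiple
  -- of the logarithm.
  have hexp : M + Real.log (T / δ) ≤ l * (C * Real.log (T / δ)) := by
    have h1 : 1 + M / Real.log 2 ≤ C * l := (div_le_iff₀ hl).1 hC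
    have h2 := mul_le_mul_of_nonneg_right h1 (hlog2.le.trans hlog)
    have h3 : M ≤ M / Real.log 2 * Real.log (T / δ) := by
      rw [div_mul_eq_mul_div, le_div_iff₀ hlog2]
      exact mul_le_mul_of_nonneg_left hlog hM
    linarith
  have htail : ∀ n, P {ω | C * Real.log (T / δ) < D n ω} ≤ ENNReal.ofReal (δ / T) := by
    intro n
    have hpos : 0 < Real.exp (l * (C * Real.log (T / δ))) := Real.exp_pos _
    calc P {ω | C * Real.log (T / δ) < D n ω}
        ≤ P {ω | ENNReal.ofReal (Real.exp (l * (C * Real.log (T / δ))))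
            ≤ ENNReal.ofReal (Real.exp (l * D n ω))} :=
          measure_mono fun ω hω => ENNReal.ofReal_le_ofReal
            (Real.exp_le_exp.2 (mul_le_mul_of_nonneg_left (le_of_lt hω) hl.le))
      _ ≤ (∫⁻ ω, ENNReal.ofReal (Real.exp (l * D n ω)) ∂P)
            / ENNReal.ofReal (Real.exp (l * (C * Real.log (T / δ)))) :=
          meas_ge_le_lintegral_div (((hDm n).const_mul l).exp.ennreal_ofReal).aemeasurable
            (ENNReal.ofReal_pos.2 hpos).ne' ENNReal.ofReal_ne_top
      _ ≤ ENNReal.ofReal (Real.exp M)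
            / ENNReal.ofReal (Real.exp (l * (C * Real.log (T / δ)))) :=
          ENNReal.div_le_div_right (hD n) _
      _ = ENNReal.ofReal (Real.exp (M - l * (C * Real.log (T / δ)))) := by
          rw [← ENNReal.ofReal_div_of_pos hpos, Real.exp_sub]
      _ ≤ ENNReal.ofReal (δ / T) := by
          refine ENNReal.ofReal_le_ofReal ?_
          have hinv : Real.log (δ / T) = -Real.log (T / δ) := by rw [← Real.log_inv, inv_div]
          rw [← Real.le_log_iff_exp_le (div_pos hδ hT0), hinv]
          linarith
  set good := {ω | ∀ n < T, D n ω ≤ C * Real.log (T / δ)} with hgood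
  have hbad : P goodᶜ ≤ ENNReal.ofReal δ := by
    have hsub : goodᶜ ⊆ ⋃ n ∈ Finset.range T, {ω | C * Real.log (T / δ) < D n ω} := by
      intro ω hω
      simp only [hgood, mem_compl_iff, mem_ofPred_eq, not_forall, not_le] at hω
      obtain ⟨n, hn, h⟩ := hω
      exact mem_biUnion (Finset.mem_coe.2 (Finset.mem_range.2 hn)) h
    calc P goodᶜ ≤ ∑ n ∈ Finset.range T, P {ω | C * Real.log (T / δ) < D n ω} :=
          (measure_mono hsub).trans (measure_biUnion_finset_le _ _)
      _ ≤ ∑ _n ∈ Finset.range T, ENNReal.ofReal (δ / T) := Finset.sum_le_sum fun n _ => htail n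
      _ = ENNReal.ofReal δ := by
          rw [Finset.sum_const, Finset.card_range, ← ENNReal.ofReal_nsmul, nsmul_eq_mul,
            mul_div_cancel₀ _ hT0.ne']
  rw [ENNReal.ofReal_sub _ hδ.le, ENNReal.ofReal_one, tsub_le_iff_right, ← measure_univ (μ := P),
    ← union_compl_self good]
  exact (measure_union_le _ _).trans (by gcongr)

theorem proposition1 {d : ℕ} {X : Set (EuclideanSpace ℝ (Fin d))} {Y : Set ℝ}
    (ρ : Measure (X × Y)) [IsProbabilityMeasure ρ]
    -- the reproducing kernel Hilbert space of a bounded continuous kernel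
    (H : Type*) [NormedAddCommGroup H] [InnerProductSpace ℝ H] [CompleteSpace H] [RKHS ℝ H X ℝ]
    (hK : Continuous fun p : X × X => realKernel H p.1 p.2)
    (hκ : BddAbove (range fun x : X => √(realKernel H x x)))
    -- the loss
    (φ : Y → ℝ → ℝ) (α L : ℝ) (hα : 0 < α) (hα1 : α ≤ 1) (hL : 0 < L)
    (hφ : IsHolderLoss φ α L)
    (hφ0 : BddAbove (range fun y : Y => φ y 0))
    -- a minimizer of the generalization error over `H`
    (fH : H) (hfH : IsMinOn (fun f : H => genError ρ φ f) univ fH)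
    (hφH : BddAbove (range fun z : X × Y => φ z.2 (fH z.1)))
    -- the step sizes
    (η : ℕ → ℝ) (hη : ∀ n, 0 < η n)
    (hηA : ∀ n, stepConstA α L * kernelBound H ^ 2 * η n ≤ 1)
    (hη_anti : ∀ n, η (n + 1) ≤ η n)
    (hη_sum : Summable fun n => η n ^ 2) :
    ∃ C : ℝ, 1 ≤ C ∧
      -- the examples are independent with law `ρ`
      ∀ (Ω : Type*) [MeasurableSpace Ω] (P : Measure Ω) [IsProbabilityMeasure P]
        (Z : ℕ → Ω → X × Y), (∀ n, Measurable (Z n)) → (∀ n, P.map (Z n) = ρ) → iIndepFun Z P →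
      ∀ (T : ℕ) (δ : ℝ), 1 ≤ T → 0 < δ → δ < 1 → 2 * δ ≤ T →
        ENNReal.ofReal (1 - δ) ≤
          P {ω | ∀ n < T, ‖ogd H φ η (fun k => Z k ω) n - fH‖ ^ 2 ≤ C * Real.log (T / δ)} := by
  obtain ⟨M, l, hM, hl, hexp⟩ := exists_lintegral_exp_ogd_le ρ hK hκ hα hα1 hL hφ hφ0 fH hfH
    hφH hη hηA (antitone_nat_of_succ_le hη_anti) hη_sum
  refine ⟨max 1 ((1 + M / Real.log 2) / l), le_max_left _ _,
    fun Ω _ P _ Z hZ hlaw hind T δ hT hδ _ hTδ => ?_⟩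
  refine le_measure_forall_le_mul_log P hM hl (le_max_right _ _)
    (fun n ω => ‖ogd H φ η (fun k => Z k ω) n - fH‖ ^ 2) (hexp Ω P Z hZ hlaw hind) (fun n => ?_)
    hT hδ hTδ
  exact ((((stronglyMeasurable_ogd hK hφ hα n).comp_measurable
    (measurable_pi_iff.2 hZ)).sub stronglyMeasurable_const).norm.measurable).pow_const 2
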